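/- For two linear subspaces $\mathcal X,\mathcal X'$ of $\mathbb R^m$, possibly of different dimensions, let $D(\mathcal X,\mathcal X')=\frac1{\sqrt2}\|P_{\mathcal X}-P_{\mathcal X'}\|_F$ be the projection $F$-norm distance, where $P_{\mathcal X}$ is the matrix of the orthogonal projection onto $\mathcal X$ and $\|\cdot\|_F$ is the Frobenius norm. Theorem. For every $\varepsilon>0$ there are a constant $c$ with $0<c<\varepsilon$ and an integer $n_0$, both depending only on $\varepsilon$, such that the following holds for all integers $d,L\ge 0$ and all $n,N$ with $n\ge n_0$, $d\le cn$ and $n<N$. Let $\mathcal X_1,\dots,\mathcal X_L$ be linear subspaces of $\mathbb R^N$, each of dimension at most $d$, let $\Phi$ be a random $n\times N$ matrix with independent entries of law $\mathcal N(0,1/n)$, and let $\mathcal Y_k=\{\Phi x: x\in\mathcal X_k\}\subseteq\mathbb R^n$ for $k=1,\dots,L$. Then, with probability at least $$1-\frac{2dL(L-1)}{(\varepsilon-d/n)^2\,n},$$ one has, simultaneously for all $i,j\in\{1,\dots,L\}$, $$(1-\varepsilon)\,D^2(\mathcal X_i,\mathcal X_j)\le D^2(\mathcal Y_i,\mathcal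 Y_j)\le(1+\varepsilon)\,D^2(\mathcal X_i,\mathcal X_j).$$ -/

import Mathlib

open MeasureTheory ProbabilityTheory
open scoped NNReal

/-- The matrix, in the standard basis of `ℝ^m`, of the orthogonal projection onto `U`. -/
noncomputable def projMatrix {m : ℕ} (U : Submodule ℝ (EuclideanSpace ℝ (Fin m))) :
    Matrix (Fin m) (Fin m) ℝ :=
  Matrix.of fun i j => U.starProjection (EuclideanSpace.single j 1) i

open scoped Matrix.Norms.Frobenius in
/-- The (generalized) projection F-norm distance `D(U, V) = ‖P_U - P_V‖_F / √2` between two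
subspaces of `ℝ^m`, possibly of different dimensions. -/
noncomputable def projFDist {m : ℕ} (U V : Submodule ℝ (EuclideanSpace ℝ (Fin m))) : ℝ :=
  1 / √2 * ‖projMatrix U - projMatrix V‖

/-- The image `{A x | x ∈ U}` of a subspace `U` of `ℝ^N` under an `n × N` matrix `A`. -/
noncomputable def projectSubspace {n N : ℕ} (A : Matrix (Fin n) (Fin N) ℝ)
    (U : Submodule ℝ (EuclideanSpace ℝ (Fin N))) : Submodule ℝ (EuclideanSpace ℝ (Fin n)) :=
  U.map (Matrix.toEuclideanLin A)

/-- A random `n × N` matrix whose entries are independent with law `N(0, 1/n)`. -/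
structure IsGaussianMatrix {Ω : Type*} [MeasurableSpace Ω] (P : Measure Ω) {n N : ℕ}
    (Φ : Ω → Matrix (Fin n) (Fin N) ℝ) : Prop where
  hasLaw : ∀ i j, HasLaw (fun ω => Φ ω i j) (gaussianReal 0 (1 / (n : ℝ≥0))) P
  indep : iIndepFun (fun (p : Fin n × Fin N) ω => Φ ω p.1 p.2) P

/-! With Hilbert–Schmidt norms, 2D²(U, V) = ‖P_{Vᗮ} P_U‖² + ‖P_{Uᗮ} P_V‖² (`projFDist_sq`). Each
term changes by a bounded factor under any map A that nearly preserves norms on U + V: if B lifts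
P_{AU} to U, then P_{(AV)ᗮ} P_{AU} = P_{(AV)ᗮ} A P_{Vᗮ} P_U B, since A P_V B lands in AV. Inverting
A on U + V gives the reverse inequality, so distortion δ of squared norms costs a factor (1 + δ)/(1
- δ) (`projFDist_map_sq_bounds`).

It remains that Φ has distortion δ = ε/(2 + ε) on every X i + X j. A Chernoff bound at one unit
vector and a net of at most 5^{2d} points give failure probability at most 5^{2d} · 2ρⁿ with ρ < 1.
For d ≤ cn this decays exponentially, hence lies below 2/(ε²n), and a union bound over the L(L - 1)
ordered pairs concludes. -/

/-! ### Hilbert–Schmidt norms and the distance formula -/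

/-- The squared Hilbert–Schmidt norm of a linear map between Euclidean spaces. -/
noncomputable def hsNormSq {m k : ℕ}
    (T : EuclideanSpace ℝ (Fin m) →L[ℝ] EuclideanSpace ℝ (Fin k)) : ℝ :=
  ∑ i, ‖T (EuclideanSpace.single i 1)‖ ^ 2

lemma hsNormSq_adjoint {m k : ℕ}
    (T : EuclideanSpace ℝ (Fin m) →L[ℝ] EuclideanSpace ℝ (Fin k)) :
    hsNormSq (ContinuousLinearMap.adjoint T) = hsNormSq T := by
  have key : ∀ (i : Fin m) (j : Fin k),
      ContinuousLinearMap.adjoint T (EuclideanSpace.single j 1) i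
        = T (EuclideanSpace.single i 1) j := by
    intro i j
    have h := ContinuousLinearMap.adjoint_inner_right T
      (EuclideanSpace.single i 1) (EuclideanSpace.single j 1)
    simpa [EuclideanSpace.inner_single_left, EuclideanSpace.inner_single_right] using h
  simp only [hsNormSq, EuclideanSpace.norm_sq_eq, key]
  exact Finset.sum_comm

lemma hsNormSq_comp_le_left {l m k : ℕ}
    (S : EuclideanSpace ℝ (Fin m) →L[ℝ] EuclideanSpace ℝ (Fin k))
    (T : EuclideanSpace ℝ (Fin l) →L[ℝ] EuclideanSpace ℝ (Fin m)) {K : ℝ}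
    (h : ∀ v, ‖S (T v)‖ ≤ K * ‖T v‖) :
    hsNormSq (S ∘L T) ≤ K ^ 2 * hsNormSq T := by
  rw [hsNormSq, hsNormSq, Finset.mul_sum]
  refine Finset.sum_le_sum fun i _ => ?_
  rw [← mul_pow]
  exact pow_le_pow_left₀ (norm_nonneg _) (h _) 2

lemma hsNormSq_comp_le_right {l m k : ℕ}
    (S : EuclideanSpace ℝ (Fin m) →L[ℝ] EuclideanSpace ℝ (Fin k))
    (T : EuclideanSpace ℝ (Fin l) →L[ℝ] EuclideanSpace ℝ (Fin m)) {K : ℝ} (hK : 0 ≤ K)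
    (h : ∀ v, ‖T v‖ ≤ K * ‖v‖) :
    hsNormSq (S ∘L T) ≤ K ^ 2 * hsNormSq S := by
  rw [← hsNormSq_adjoint (S ∘L T), ← hsNormSq_adjoint S, ContinuousLinearMap.adjoint_comp]
  refine hsNormSq_comp_le_left _ _ fun v => ?_
  refine (ContinuousLinearMap.le_opNorm _ _).trans ?_
  gcongr
  rw [LinearIsometryEquiv.norm_map]
  exact T.opNorm_le_bound hK h

/-- P_U - P_V = P_{Vᗮ} P_U - P_V P_{Uᗮ}, and the two terms have orthogonal ranges, so Pythagoras
applies column by column; taking adjoints turns P_V P_{Uᗮ} into P_{Uᗮ} P_V. -/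
lemma projFDist_sq {m : ℕ} (U V : Submodule ℝ (EuclideanSpace ℝ (Fin m))) :
    projFDist U V ^ 2 =
      1 / 2 * (hsNormSq (Vᗮ.starProjection ∘L U.starProjection)
        + hsNormSq (Uᗮ.starProjection ∘L V.starProjection)) := by
  have h1 : projFDist U V ^ 2 = 1 / 2 * hsNormSq (U.starProjection - V.starProjection) := by
    rw [projFDist, Matrix.frobenius_norm_def, ← Real.sqrt_eq_rpow, mul_pow, div_pow,
      Real.sq_sqrt (by positivity), Real.sq_sqrt (by positivity), one_pow, hsNormSq,
      Finset.sum_comm]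
    simp [projMatrix, EuclideanSpace.norm_sq_eq]
  have h2 : hsNormSq (U.starProjection - V.starProjection) =
      hsNormSq (Vᗮ.starProjection ∘L U.starProjection)
        + hsNormSq (V.starProjection ∘L Uᗮ.starProjection) := by
    simp only [hsNormSq, ← Finset.sum_add_distrib]
    refine Finset.sum_congr rfl fun i _ => ?_
    set e : EuclideanSpace ℝ (Fin m) := EuclideanSpace.single i 1
    have h3 : (U.starProjection - V.starProjection) e =
        Vᗮ.starProjection (U.starProjection e) - V.starProjection (Uᗮ.starProjection e) := by
      simp [Submodule.starProjection_orthogonal_val]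
    rw [h3]
    have h4 : inner ℝ (Vᗮ.starProjection (U.starProjection e))
        (V.starProjection (Uᗮ.starProjection e)) = 0 :=
      Submodule.inner_left_of_mem_orthogonal (Submodule.starProjection_apply_mem V _)
        (Submodule.starProjection_apply_mem Vᗮ _)
    simp only [pow_two]
    rw [norm_sub_sq_eq_norm_sq_add_norm_sq_real h4]
    rfl
  have h5 : hsNormSq (V.starProjection ∘L Uᗮ.starProjection) =
      hsNormSq (Uᗮ.starProjection ∘L V.starProjection) := by
    rw [← hsNormSq_adjoint, ContinuousLinearMap.adjoint_comp]
    simp only [← ContinuousLinearMap.star_eq_adjoint, (isSelfAdjoint_starProjection _).star_eq]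
  rw [h1, h2, h5]

/-! ### Distances under a near-isometry -/

lemma exists_lift_starProjection_map {m k : ℕ}
    (A : EuclideanSpace ℝ (Fin m) →ₗ[ℝ] EuclideanSpace ℝ (Fin k))
    (U : Submodule ℝ (EuclideanSpace ℝ (Fin m))) :
    ∃ B : EuclideanSpace ℝ (Fin k) →L[ℝ] EuclideanSpace ℝ (Fin m),
      (∀ w, B w ∈ U) ∧ ∀ w, A (B w) = (U.map A).starProjection w := by
  obtain ⟨g, hg⟩ := (A.submoduleMap U).exists_rightInverse_of_surjective
    (LinearMap.range_eq_top.2 (A.submoduleMap_surjective U))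
  refine ⟨LinearMap.toContinuousLinearMap
    (U.subtype ∘ₗ g ∘ₗ (U.map A).orthogonalProjectionOnto.toLinearMap), fun w => ?_, fun w => ?_⟩
  · exact (g ((U.map A).orthogonalProjectionOnto w)).2
  · exact congrArg Subtype.val (LinearMap.congr_fun hg ((U.map A).orthogonalProjectionOnto w))

lemma hsNormSq_map_le {m k : ℕ} (A : EuclideanSpace ℝ (Fin m) →ₗ[ℝ] EuclideanSpace ℝ (Fin k))
    (U V : Submodule ℝ (EuclideanSpace ℝ (Fin m))) {a b : ℝ} (ha : 0 ≤ a)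
    (hA : ∀ v ∈ U ⊔ V, ‖v‖ ≤ a * ‖A v‖) (hA' : ∀ v ∈ U ⊔ V, ‖A v‖ ≤ b * ‖v‖) :
    hsNormSq ((V.map A)ᗮ.starProjection ∘L (U.map A).starProjection) ≤
      (a * b) ^ 2 * hsNormSq (Vᗮ.starProjection ∘L U.starProjection) := by
  obtain ⟨B, hBU, hAB⟩ := exists_lift_starProjection_map A U
  have hBn : ∀ w, ‖B w‖ ≤ a * ‖w‖ := fun w =>
    (hA _ (Submodule.mem_sup_left (hBU w))).trans (by
      rw [hAB]; gcongr; exact Submodule.norm_starProjection_apply_le _ _)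
  have heq : (V.map A)ᗮ.starProjection ∘L (U.map A).starProjection =
      ((V.map A)ᗮ.starProjection ∘L LinearMap.toContinuousLinearMap A) ∘L
        ((Vᗮ.starProjection ∘L U.starProjection) ∘L B) := by
    ext1 w
    have h1 : U.starProjection (B w) = B w := Submodule.starProjection_eq_self_iff.2 (hBU w)
    have h2 : A (V.starProjection (B w)) ∈ V.map A :=
      Submodule.mem_map_of_mem (Submodule.starProjection_apply_mem V _)
    have h3 : (V.map A)ᗮ.starProjection (A (V.starProjection (B w))) = 0 := by
      rw [Submodule.starProjection_orthogonal_val, Submodule.starProjection_eq_self_iff.2 h2,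
        sub_self]
    simp only [ContinuousLinearMap.comp_apply, LinearMap.coe_toContinuousLinearMap']
    rw [h1, Submodule.starProjection_orthogonal_val (K := V), map_sub, map_sub, h3, sub_zero, hAB]
  have hmem : ∀ w, Vᗮ.starProjection (U.starProjection w) ∈ U ⊔ V := fun w => by
    rw [Submodule.starProjection_orthogonal_val]
    exact sub_mem (Submodule.mem_sup_left (Submodule.starProjection_apply_mem U _))
      (Submodule.mem_sup_right (Submodule.starProjection_apply_mem V _))
  have hleft : ∀ w, ‖((V.map A)ᗮ.starProjection ∘L LinearMap.toContinuousLinearMap A)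
      (((Vᗮ.starProjection ∘L U.starProjection) ∘L B) w)‖ ≤
        b * ‖((Vᗮ.starProjection ∘L U.starProjection) ∘L B) w‖ := by
    intro w
    simp only [ContinuousLinearMap.comp_apply, LinearMap.coe_toContinuousLinearMap']
    exact (Submodule.norm_starProjection_apply_le _ _).trans (hA' _ (hmem (B w)))
  rw [heq]
  calc _ ≤ b ^ 2 * hsNormSq ((Vᗮ.starProjection ∘L U.starProjection) ∘L B) :=
        hsNormSq_comp_le_left _ _ hleft
    _ ≤ b ^ 2 * (a ^ 2 * hsNormSq (Vᗮ.starProjection ∘L U.starProjection)) := by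
        gcongr
        exact hsNormSq_comp_le_right _ _ ha hBn
    _ = _ := by ring

lemma projFDist_map_sq_le {m k : ℕ}
    (A : EuclideanSpace ℝ (Fin m) →ₗ[ℝ] EuclideanSpace ℝ (Fin k))
    (U V : Submodule ℝ (EuclideanSpace ℝ (Fin m))) {a b : ℝ} (ha : 0 ≤ a)
    (hA : ∀ v ∈ U ⊔ V, ‖v‖ ≤ a * ‖A v‖) (hA' : ∀ v ∈ U ⊔ V, ‖A v‖ ≤ b * ‖v‖) :
    projFDist (U.map A) (V.map A) ^ 2 ≤ (a * b) ^ 2 * projFDist U V ^ 2 := by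
  rw [projFDist_sq, projFDist_sq]
  have h1 := hsNormSq_map_le A U V ha hA hA'
  rw [sup_comm] at hA hA'
  have h2 := hsNormSq_map_le A V U ha hA hA'
  linarith

/-- The upper bound, applied to a left inverse of A on U + V; the constants a and b exchange roles.
-/
lemma le_projFDist_map_sq {m k : ℕ}
    (A : EuclideanSpace ℝ (Fin m) →ₗ[ℝ] EuclideanSpace ℝ (Fin k))
    (U V : Submodule ℝ (EuclideanSpace ℝ (Fin m))) {a b : ℝ} (hb : 0 ≤ b)
    (hA : ∀ v ∈ U ⊔ V, ‖v‖ ≤ a * ‖A v‖) (hA' : ∀ v ∈ U ⊔ V, ‖A v‖ ≤ b * ‖v‖) :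
    projFDist U V ^ 2 ≤ (a * b) ^ 2 * projFDist (U.map A) (V.map A) ^ 2 := by
  obtain ⟨C, hC⟩ := (A.domRestrict (U ⊔ V)).exists_leftInverse_of_injective (by
    rw [LinearMap.ker_eq_bot']
    rintro ⟨v, hv⟩ h
    have h0 : A v = 0 := h
    have := hA v hv
    rw [h0, norm_zero, mul_zero] at this
    exact Subtype.ext (norm_le_zero_iff.1 this))
  set C' := (U ⊔ V).subtype ∘ₗ C
  have hCA : ∀ v ∈ U ⊔ V, C' (A v) = v := fun v hv =>
    congrArg Subtype.val (LinearMap.congr_fun hC ⟨v, hv⟩)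
  have hmap : ∀ W ≤ U ⊔ V, (W.map A).map C' = W := by
    intro W hW
    ext v
    simp only [Submodule.mem_map, exists_exists_and_eq_and]
    constructor
    · rintro ⟨w, hw, rfl⟩
      rwa [hCA w (hW hw)]
    · exact fun hv => ⟨v, hv, hCA v (hW hv)⟩
  have h := projFDist_map_sq_le (b := a) C' (U.map A) (V.map A) hb
  rw [hmap U le_sup_left, hmap V le_sup_right, ← Submodule.map_sup, mul_comm b a] at h
  apply h
  · rintro _ ⟨v, hv, rfl⟩
    rw [hCA v hv]
    exact hA' v hv
  · rintro _ ⟨v, hv, rfl⟩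
    rw [hCA v hv]
    exact hA v hv

/-- A linear map that distorts squared norms on `U + V` by a factor at most `1 ± δ` with
`δ ≤ ε / (2 + ε)` distorts the squared distance between `U` and `V` by a factor at most `1 ± ε`. -/
lemma projFDist_map_sq_bounds {m k : ℕ}
    (A : EuclideanSpace ℝ (Fin m) →ₗ[ℝ] EuclideanSpace ℝ (Fin k))
    (U V : Submodule ℝ (EuclideanSpace ℝ (Fin m))) {ε δ : ℝ} (hε : 0 < ε) (hδ : 0 ≤ δ)
    (hδε : δ * (2 + ε) ≤ ε) (hA : ∀ v ∈ U ⊔ V, |‖A v‖ ^ 2 - ‖v‖ ^ 2| ≤ δ * ‖v‖ ^ 2) :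
    (1 - ε) * projFDist U V ^ 2 ≤ projFDist (U.map A) (V.map A) ^ 2 ∧
      projFDist (U.map A) (V.map A) ^ 2 ≤ (1 + ε) * projFDist U V ^ 2 := by
  -- The hypothesis `hδε` is equivalent to 1 + δ ≤ (1 + ε)(1 - δ); the lower bound needs only the
  -- weaker δ(2 - ε) ≤ ε.
  have hδ1 : δ < 1 := by nlinarith
  have hb : ∀ v ∈ U ⊔ V, ‖A v‖ ≤ √(1 + δ) * ‖v‖ := by
    intro v hv
    refine le_of_sq_le_sq ?_ (by positivity)
    rw [mul_pow, Real.sq_sqrt (by linarith)]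
    linarith [(abs_le.1 (hA v hv)).2]
  have ha : ∀ v ∈ U ⊔ V, ‖v‖ ≤ (√(1 - δ))⁻¹ * ‖A v‖ := by
    intro v hv
    rw [inv_mul_eq_div, le_div_iff₀ (Real.sqrt_pos.2 (by linarith))]
    refine le_of_sq_le_sq ?_ (by positivity)
    rw [mul_pow, Real.sq_sqrt (by linarith)]
    linarith [(abs_le.1 (hA v hv)).1]
  have hab : ((√(1 - δ))⁻¹ * √(1 + δ)) ^ 2 = (1 + δ) / (1 - δ) := by
    rw [mul_pow, inv_pow, Real.sq_sqrt (by linarith), Real.sq_sqrt (by linarith)]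
    ring
  have h1 := projFDist_map_sq_le A U V (by positivity) ha hb
  have h2 := le_projFDist_map_sq A U V (by positivity) ha hb
  rw [hab] at h1 h2
  have hX := sq_nonneg (projFDist U V)
  have hY := sq_nonneg (projFDist (U.map A) (V.map A))
  have hd : 0 < 1 - δ := by linarith
  constructor
  · rw [div_mul_eq_mul_div, le_div_iff₀ hd] at h2
    have h3 : (1 - ε) * (1 + δ) ≤ 1 - δ := by nlinarith
    have h4 := mul_le_mul_of_nonneg_right h3 hX
    nlinarith
  · refine h1.trans (mul_le_mul_of_nonneg_right ?_ hX)
    rw [div_le_iff₀ hd]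
    nlinarith

/-! ### Nets on the unit sphere -/

/-- A 1/2-separated subset of the sphere of maximal cardinality is a net. -/
lemma exists_finset_net_sphere (E : Type*) [NormedAddCommGroup E] [NormedSpace ℝ E]
    [FiniteDimensional ℝ E] :
    ∃ s : Finset E, s.card ≤ 5 ^ Module.finrank ℝ E ∧ (∀ c ∈ s, ‖c‖ = 1) ∧
      ∀ x : E, ‖x‖ = 1 → ∃ c ∈ s, ‖x - c‖ < 1 / 2 := by
  classical
  let C : Set ℕ := {N | ∃ s : Finset E, s.card = N ∧ (∀ c ∈ s, ‖c‖ = 1) ∧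
    ∀ c ∈ s, ∀ d ∈ s, c ≠ d → 1 / 2 ≤ ‖c - d‖}
  have hC : ∀ N ∈ C, N ≤ 5 ^ Module.finrank ℝ E := by
    rintro N ⟨s, rfl, h1, h2⟩
    -- Doubling gives 1-separated points in the ball of radius 2, the setting of the Besicovitch
    -- bound 5^dim.
    have hinj : Function.Injective fun x : E => (2 : ℝ) • x := smul_right_injective E two_ne_zero
    rw [← Finset.card_image_of_injective s hinj]
    refine Besicovitch.card_le_of_separated _ ?_ ?_
    · simp only [Finset.mem_image]
      rintro _ ⟨c, hc, rfl⟩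
      simp [norm_smul, h1 c hc]
    · simp only [Finset.mem_image]
      rintro _ ⟨c, hc, rfl⟩ _ ⟨d, hd, rfl⟩ hcd
      have := h2 c hc d hd fun h => hcd (by rw [h])
      rw [← smul_sub, norm_smul, Real.norm_two]
      linarith
  have hmem : sSup C ∈ C := Nat.sSup_mem ⟨0, ∅, by simp⟩ ⟨_, hC⟩
  obtain ⟨s, hs, h1, h2⟩ := hmem
  refine ⟨s, hs ▸ hC _ ⟨s, hs, h1, h2⟩, h1, fun x hx => ?_⟩
  by_contra! hcon
  have hxs : x ∉ s := fun h => by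
    have := hcon x h
    rw [sub_self, norm_zero] at this
    norm_num at this
  have hins : (insert x s).card ∈ C := by
    refine ⟨_, rfl, ?_, ?_⟩
    · simp only [Finset.mem_insert]
      rintro c (rfl | hc)
      exacts [hx, h1 c hc]
    · simp only [Finset.mem_insert]
      rintro c (rfl | hc) d (rfl | hd) hcd
      · exact absurd rfl hcd
      · exact hcon d hd
      · rw [norm_sub_rev]; exact hcon c hc
      · exact h2 c hc d hd hcd
  have := le_csSup ⟨_, hC⟩ hins
  rw [Finset.card_insert_of_notMem hxs] at this
  omega

lemma norm_smul_sub_smul_sq {E : Type*} [NormedAddCommGroup E] [InnerProductSpace ℝ E] (y z : E)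
    (α β : ℝ) : ‖α • y - β • z‖ ^ 2 =
      α ^ 2 * ‖y‖ ^ 2 - 2 * α * β * inner ℝ y z + β ^ 2 * ‖z‖ ^ 2 := by
  rw [norm_sub_sq_real, norm_smul, norm_smul, inner_smul_left, inner_smul_right, mul_pow, mul_pow,
    Real.norm_eq_abs, Real.norm_eq_abs, sq_abs, sq_abs]
  simp only [conj_trivial]
  ring

/-- A linear map that nearly preserves norms on a `1 / 2`-net of the unit sphere nearly preserves
all norms. -/
lemma abs_norm_sq_sub_norm_sq_le_of_net {E F : Type*} [NormedAddCommGroup E]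
    [InnerProductSpace ℝ E] [FiniteDimensional ℝ E] [NormedAddCommGroup F] [InnerProductSpace ℝ F]
    (A : E →ₗ[ℝ] F) (s : Finset E) (hs : ∀ c ∈ s, ‖c‖ = 1)
    (hnet : ∀ x : E, ‖x‖ = 1 → ∃ c ∈ s, ‖x - c‖ < 1 / 2) {t : ℝ}
    (ht : ∀ c ∈ s, |‖A c‖ ^ 2 - 1| ≤ t) (x : E) :
    |‖A x‖ ^ 2 - ‖x‖ ^ 2| ≤ 32 * t * ‖x‖ ^ 2 := by
  rcases eq_or_ne x 0 with rfl | hx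
  · simp
  set q : E → ℝ := fun x => ‖A x‖ ^ 2 - ‖x‖ ^ 2 with hq
  have hqs : ∀ (r : ℝ) v, q (r • v) = r ^ 2 * q v := by
    intro r v
    simp only [hq, map_smul, norm_smul, mul_pow, Real.norm_eq_abs, sq_abs]
    ring
  have hcont : Continuous fun v => |q v| := by
    have : Continuous A := A.continuous_of_finiteDimensional
    fun_prop
  have hunit : ∀ v : E, v ≠ 0 → ‖(‖v‖⁻¹ : ℝ) • v‖ = 1 := fun v hv => norm_smul_inv_norm hv
  obtain ⟨x₀, hx₀, hmax⟩ := (isCompact_sphere (0 : E) 1).exists_isMaxOn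
    ⟨_, by simpa using hunit x hx⟩ hcont.continuousOn
  have hn₀ : ‖x₀‖ = 1 := by simpa using hx₀
  have hM : ∀ v, |q v| ≤ |q x₀| * ‖v‖ ^ 2 := by
    intro v
    rcases eq_or_ne v 0 with rfl | hv
    · simp [hq]
    have h1 : |q ((‖v‖⁻¹ : ℝ) • v)| ≤ |q x₀| := hmax (by simpa using hunit v hv)
    have hv' : 0 < ‖v‖ := norm_pos_iff.2 hv
    rw [hqs, abs_mul, abs_of_nonneg (by positivity), inv_pow, inv_mul_le_iff₀ (by positivity)] at h1
    linarith
  obtain ⟨c, hc, hxc⟩ := hnet x₀ hn₀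
  have hqc : |q c| ≤ t := by simpa [hq, hs c hc] using ht c hc
  -- These are 2(x₀ - c) ± (x₀ + c)/2. The cross terms cancel in q u - q w, and the weights make
  -- ‖u‖² + ‖w‖² ≤ 31/8 < 4, so the maximum |q x₀| can be absorbed: |q x₀|/8 ≤ 4t.
  set u := (5 / 2 : ℝ) • x₀ - (3 / 2 : ℝ) • c with hu
  set w := (3 / 2 : ℝ) • x₀ - (5 / 2 : ℝ) • c with hw
  have hpol : q u - q w = 4 * (q x₀ - q c) := by
    simp only [hq, hu, hw, map_sub, map_smul, norm_smul_sub_smul_sq]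
    ring
  have hsum : ‖u‖ ^ 2 + ‖w‖ ^ 2 ≤ 31 / 8 := by
    rw [hu, hw, norm_smul_sub_smul_sq, norm_smul_sub_smul_sq, hn₀, hs c hc]
    have h1 : ‖x₀ - c‖ ^ 2 < (1 / 2) ^ 2 := pow_lt_pow_left₀ hxc (norm_nonneg _) two_ne_zero
    rw [norm_sub_sq_real, hn₀, hs c hc] at h1
    linarith
  have h4 : 4 * |q x₀| ≤ 4 * t + |q x₀| * (31 / 8) := by
    have h1 : 4 * |q x₀ - q c| ≤ |q u| + |q w| := by
      rw [show (4 : ℝ) * |q x₀ - q c| = |4 * (q x₀ - q c)| by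
        rw [abs_mul, abs_of_pos (by norm_num : (0 : ℝ) < 4)], ← hpol]
      exact abs_sub _ _
    have h2 := abs_sub_abs_le_abs_sub (q x₀) (q c)
    have h3 := mul_le_mul_of_nonneg_left hsum (abs_nonneg (q x₀))
    linarith [hM u, hM w]
  refine (hM x).trans (mul_le_mul_of_nonneg_right ?_ (by positivity))
  linarith

lemma exists_finset_net_subspace {E : Type*} [NormedAddCommGroup E] [InnerProductSpace ℝ E]
    (V : Submodule ℝ E) [FiniteDimensional ℝ V] :
    ∃ s : Finset V, s.card ≤ 5 ^ Module.finrank ℝ V ∧ (∀ c ∈ s, ‖(c : E)‖ = 1) ∧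
      ∀ {F : Type*} [NormedAddCommGroup F] [InnerProductSpace ℝ F] (A : E →ₗ[ℝ] F) (t : ℝ),
        (∀ c ∈ s, |‖A c‖ ^ 2 - 1| ≤ t) →
        ∀ v ∈ V, |‖A v‖ ^ 2 - ‖v‖ ^ 2| ≤ 32 * t * ‖v‖ ^ 2 := by
  obtain ⟨s, hcard, hs, hnet⟩ := exists_finset_net_sphere V
  exact ⟨s, hcard, hs, fun A t ht v hv =>
    abs_norm_sq_sub_norm_sq_le_of_net (A.domRestrict V) s hs hnet ht ⟨v, hv⟩⟩

/-! ### Gaussian concentration -/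

lemma mgf_sq_gaussianReal {v : ℝ≥0} (hv : v ≠ 0) {s : ℝ} (hs : 2 * s * v < 1) :
    mgf (fun x => x ^ 2) (gaussianReal 0 v) s = (√(1 - 2 * s * v))⁻¹ := by
  have hv' : (0 : ℝ) < v := by positivity
  have h1 : 0 < 1 - 2 * s * v := by linarith
  rw [mgf, integral_gaussianReal_eq_integral_smul hv]
  have h2 : ∀ x : ℝ, gaussianPDFReal 0 v x • Real.exp (s * x ^ 2) =
      (√(2 * Real.pi * v))⁻¹ * Real.exp (-((1 - 2 * s * v) / (2 * v)) * x ^ 2) := by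
    intro x
    rw [gaussianPDFReal, smul_eq_mul, mul_assoc, ← Real.exp_add]
    congr 2
    field_simp
    ring
  simp only [h2]
  rw [integral_const_mul, integral_gaussian, ← Real.sqrt_inv, ← Real.sqrt_inv,
    ← Real.sqrt_mul (by positivity)]
  congr 1
  field_simp

/-- The coordinates of a Gaussian matrix applied to a unit vector are independent Gaussians. -/
lemma IsGaussianMatrix.toEuclideanLin_apply {Ω : Type*} [MeasurableSpace Ω] {P : Measure Ω}
    [IsProbabilityMeasure P] {n N : ℕ} {Φ : Ω → Matrix (Fin n) (Fin N) ℝ}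
    (h : IsGaussianMatrix P Φ) {x : EuclideanSpace ℝ (Fin N)} (hx : ‖x‖ = 1) :
    iIndepFun (fun i ω => (Matrix.toEuclideanLin (Φ ω) x) i) P ∧
      ∀ i, HasLaw (fun ω => (Matrix.toEuclideanLin (Φ ω) x) i) (gaussianReal 0 (1 / (n : ℝ≥0))) P := by
  have happ : ∀ ω i, (Matrix.toEuclideanLin (Φ ω) x) i = ∑ j, Φ ω i j * x j := by
    intro ω i
    simp [Matrix.toLpLin_apply, Matrix.mulVec, dotProduct]
  simp only [happ]
  have hG : ∀ i j, HasGaussianLaw (fun ω => Φ ω i j) P := fun i j => (h.hasLaw i j).hasGaussianLaw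
  have hjoint : HasGaussianLaw (fun ω (p : Fin n × Fin N) => Φ ω p.1 p.2) P :=
    h.indep.hasGaussianLaw fun p => hG p.1 p.2
  let L : (Fin n × Fin N → ℝ) →L[ℝ] (Fin n → ℝ) :=
    ContinuousLinearMap.pi fun i => ∑ j, x j • ContinuousLinearMap.proj (i, j)
  have hL : HasGaussianLaw (fun ω i => ∑ j, Φ ω i j * x j) P := by
    convert! hjoint.map_fun L using 3
    simp [L, mul_comm]
  have hcov : ∀ i k, cov[fun ω => ∑ j, Φ ω i j * x j, fun ω => ∑ j, Φ ω k j * x j; P] =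
      if i = k then 1 / (n : ℝ) else 0 := by
    intro i k
    have hmem : ∀ i j, MemLp (fun ω => Φ ω i j * x j) 2 P := fun i j =>
      (hG i j).memLp_two.mul_const _
    rw [covariance_fun_sum_fun_sum (fun j => hmem i j) (fun j => hmem k j)]
    have hentry : ∀ j l, cov[fun ω => Φ ω i j, fun ω => Φ ω k l; P] =
        if i = k ∧ j = l then 1 / (n : ℝ) else 0 := by
      intro j l
      split_ifs with hij
      · obtain ⟨rfl, rfl⟩ := hij
        rw [covariance_self (hG i j).aemeasurable, (h.hasLaw i j).variance_eq,
          variance_id_gaussianReal]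
        simp
      · exact (h.indep.indepFun (i := (i, j)) (j := (k, l)) (by simpa using hij)).covariance_eq_zero
          (hG i j).memLp_two (hG k l).memLp_two
    simp only [covariance_mul_const_left, covariance_mul_const_right, hentry]
    split_ifs with hik
    · have hx2 : ∑ j, x j ^ 2 = 1 := by
        have := EuclideanSpace.real_norm_sq_eq x
        rw [hx] at this
        linarith
      simp only [hik, true_and, ite_mul, zero_mul, Finset.sum_ite_eq, Finset.mem_univ, if_true]
      calc _ = 1 / (n : ℝ) * ∑ j, x j ^ 2 := by
            rw [Finset.mul_sum]; exact Finset.sum_congr rfl fun j _ => by ring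
        _ = _ := by rw [hx2, mul_one]
    · simp [hik]
  constructor
  · exact hL.iIndepFun_of_covariance_eq_zero fun i k hik => by rw [hcov, if_neg hik]
  · intro i
    have hi : HasGaussianLaw (fun ω => ∑ j, Φ ω i j * x j) P := hL.eval i
    refine ⟨hi.aemeasurable, ?_⟩
    rw [hi.map_eq_gaussianReal]
    congr 1
    · rw [integral_finsetSum _ fun j _ => (hG i j).integrable.mul_const _]
      refine Finset.sum_eq_zero fun j _ => ?_
      rw [integral_mul_const, (h.hasLaw i j).integral_eq, integral_id_gaussianReal, zero_mul]
    · rw [← covariance_self hi.aemeasurable, hcov, if_pos rfl]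
      ext
      simp

lemma IsGaussianMatrix.mgf_norm_sq {Ω : Type*} [MeasurableSpace Ω] {P : Measure Ω}
    [IsProbabilityMeasure P] {n N : ℕ} (hn : n ≠ 0) {Φ : Ω → Matrix (Fin n) (Fin N) ℝ}
    (h : IsGaussianMatrix P Φ) {x : EuclideanSpace ℝ (Fin N)} (hx : ‖x‖ = 1) {s : ℝ}
    (hs : 2 * s < 1) :
    mgf (fun ω => ‖Matrix.toEuclideanLin (Φ ω) x‖ ^ 2) P (n * s) = (√(1 - 2 * s))⁻¹ ^ n := by
  obtain ⟨hind, hlaw⟩ := h.toEuclideanLin_apply hx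
  have hn' : (n : ℝ) ≠ 0 := by exact_mod_cast hn
  have hsq : (fun ω => ‖Matrix.toEuclideanLin (Φ ω) x‖ ^ 2) =
      ∑ i, fun ω => ((Matrix.toEuclideanLin (Φ ω) x) i) ^ 2 := by
    ext ω
    rw [EuclideanSpace.real_norm_sq_eq, Finset.sum_apply]
  have hind' := hind.comp (fun _ y => y ^ 2) fun _ => by fun_prop
  rw [hsq]
  refine (hind'.mgf_sum₀ (fun i => (hlaw i).aemeasurable.pow_const 2) Finset.univ).trans ?_
  have hi : ∀ i, mgf ((fun y : ℝ => y ^ 2) ∘ fun ω => (Matrix.toEuclideanLin (Φ ω) x) i) P (n * s) =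
      (√(1 - 2 * s))⁻¹ := by
    intro i
    rw [← mgf_map (hlaw i).aemeasurable (by fun_prop), (hlaw i).map_eq, mgf_sq_gaussianReal]
    · congr 3
      push_cast
      field_simp
    · simpa using hn
    · push_cast
      field_simp
      linarith
  rw [Finset.prod_congr rfl fun i _ => hi i, Finset.prod_const, Finset.card_fin]

/-- Concentration of the norm of a Gaussian matrix applied to a unit vector. -/
lemma IsGaussianMatrix.exists_measure_abs_norm_sq_sub_one_le {t : ℝ} (ht : 0 < t) (ht1 : t ≤ 1) :
    ∃ ρ : ℝ, 0 < ρ ∧ ρ < 1 ∧ ∀ {Ω : Type*} [MeasurableSpace Ω] (P : Measure Ω)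
      [IsProbabilityMeasure P] {n N : ℕ} (_ : n ≠ 0) (Φ : Ω → Matrix (Fin n) (Fin N) ℝ)
      (_ : IsGaussianMatrix P Φ) (x : EuclideanSpace ℝ (Fin N)) (_ : ‖x‖ = 1),
      P.real {ω | t ≤ |‖Matrix.toEuclideanLin (Φ ω) x‖ ^ 2 - 1|} ≤ 2 * ρ ^ n := by
  -- Chernoff bases for the upper and lower tails, with exponents s = t/8 and s = -t/8. Both are
  -- below 1 by squaring and using exp y ≥ 1 + y.
  set ρ₁ := Real.exp (-(t / 8 * (1 + t))) * (√(1 - 2 * (t / 8)))⁻¹ with hρ₁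
  set ρ₂ := Real.exp (t / 8 * (1 - t)) * (√(1 - 2 * (-(t / 8))))⁻¹ with hρ₂
  have h1 : ρ₁ < 1 := by
    have hpos : 0 < 1 - 2 * (t / 8) := by linarith
    rw [hρ₁, ← div_eq_mul_inv, div_lt_one (Real.sqrt_pos.2 hpos)]
    refine Real.lt_sqrt_of_sq_lt ?_
    rw [← Real.exp_nat_mul, mul_neg, Real.exp_neg]
    have h2 := Real.add_one_le_exp (((2 : ℕ) : ℝ) * (t / 8 * (1 + t)))
    push_cast at h2 ⊢
    rw [inv_lt_comm₀ (Real.exp_pos _) hpos]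
    refine lt_of_lt_of_le ?_ h2
    rw [inv_lt_iff_one_lt_mul₀ hpos]
    nlinarith [mul_pos ht ht, mul_pos (mul_pos ht ht) ht]
  have h2 : ρ₂ < 1 := by
    have hpos : 0 < 1 - 2 * (-(t / 8)) := by linarith
    rw [hρ₂, ← div_eq_mul_inv, div_lt_one (Real.sqrt_pos.2 hpos)]
    refine Real.lt_sqrt_of_sq_lt ?_
    rw [← Real.exp_nat_mul]
    have h3 := Real.add_one_le_exp (-(((2 : ℕ) : ℝ) * (t / 8 * (1 - t))))
    rw [Real.exp_neg] at h3
    push_cast at h3 ⊢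
    have h4 : 0 < -(2 * (t / 8 * (1 - t))) + 1 := by nlinarith
    rw [le_inv_comm₀ h4 (Real.exp_pos _)] at h3
    refine lt_of_le_of_lt h3 ?_
    rw [inv_lt_iff_one_lt_mul₀ h4]
    nlinarith [mul_pos ht ht, mul_pos (mul_pos ht ht) ht]
  have hp1 : 0 < ρ₁ := mul_pos (Real.exp_pos _) (inv_pos.2 (Real.sqrt_pos.2 (by linarith)))
  have hp2 : 0 < ρ₂ := mul_pos (Real.exp_pos _) (inv_pos.2 (Real.sqrt_pos.2 (by linarith)))
  refine ⟨max ρ₁ ρ₂, lt_max_of_lt_left hp1, max_lt h1 h2, ?_⟩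
  intro Ω _ P _ n N hn Φ hΦ x hx
  have hint : ∀ s : ℝ, 2 * s < 1 →
      Integrable (fun ω => Real.exp (n * s * ‖Matrix.toEuclideanLin (Φ ω) x‖ ^ 2)) P := by
    intro s hs
    -- The integral of a non-integrable function is 0 by convention, whereas the computed moment
    -- generating function is nonzero.
    refine Integrable.of_integral_ne_zero ?_
    have := hΦ.mgf_norm_sq hn hx hs
    rw [mgf] at this
    rw [this]
    exact pow_ne_zero _ (inv_ne_zero (Real.sqrt_pos.2 (by linarith)).ne')
  have hu : P.real {ω | 1 + t ≤ ‖Matrix.toEuclideanLin (Φ ω) x‖ ^ 2} ≤ ρ₁ ^ n := by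
    refine (measure_ge_le_exp_mul_mgf (1 + t) (by positivity)
      (hint (t / 8) (by linarith))).trans_eq ?_
    rw [hΦ.mgf_norm_sq hn hx (by linarith), hρ₁, mul_pow, ← Real.exp_nat_mul]
    congr 2
    ring
  have hl : P.real {ω | ‖Matrix.toEuclideanLin (Φ ω) x‖ ^ 2 ≤ 1 - t} ≤ ρ₂ ^ n := by
    refine (measure_le_le_exp_mul_mgf (1 - t) (mul_nonpos_of_nonneg_of_nonpos (by positivity)
      (by linarith)) (hint (-(t / 8)) (by linarith))).trans_eq ?_
    rw [hΦ.mgf_norm_sq hn hx (by linarith), hρ₂, mul_pow, ← Real.exp_nat_mul]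
    congr 2
    ring
  calc P.real {ω | t ≤ |‖Matrix.toEuclideanLin (Φ ω) x‖ ^ 2 - 1|}
      ≤ P.real ({ω | 1 + t ≤ ‖Matrix.toEuclideanLin (Φ ω) x‖ ^ 2} ∪
          {ω | ‖Matrix.toEuclideanLin (Φ ω) x‖ ^ 2 ≤ 1 - t}) := by
        refine measureReal_mono fun ω hω => ?_
        simp only [Set.mem_ofPred_eq, Set.mem_union] at hω ⊢
        rcases le_abs.1 hω with h | h
        · left; linarith
        · right; linarith
    _ ≤ ρ₁ ^ n + ρ₂ ^ n := (measureReal_union_le _ _).trans (add_le_add hu hl)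
    _ ≤ 2 * max ρ₁ ρ₂ ^ n := by
        have := pow_le_pow_left₀ hp1.le (le_max_left ρ₁ ρ₂) n
        have := pow_le_pow_left₀ hp2.le (le_max_right ρ₁ ρ₂) n
        linarith

/-- A Gaussian matrix nearly preserves all norms on a fixed subspace `V`, except on an event that
is small when the dimension of `V` is a small multiple of the number of rows. -/
lemma IsGaussianMatrix.exists_measure_distortion_le {δ : ℝ} (hδ : 0 < δ) (hδ1 : δ ≤ 1) :
    ∃ ρ : ℝ, 0 < ρ ∧ ρ < 1 ∧ ∀ {Ω : Type*} [MeasurableSpace Ω] (P : Measure Ω)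
      [IsProbabilityMeasure P] {n N : ℕ} (_ : n ≠ 0) (Φ : Ω → Matrix (Fin n) (Fin N) ℝ)
      (_ : IsGaussianMatrix P Φ) (V : Submodule ℝ (EuclideanSpace ℝ (Fin N))),
      P.real {ω | ¬ ∀ v ∈ V,
        |‖Matrix.toEuclideanLin (Φ ω) v‖ ^ 2 - ‖v‖ ^ 2| ≤ δ * ‖v‖ ^ 2} ≤
        5 ^ Module.finrank ℝ V * (2 * ρ ^ n) := by
  -- Passing from the net to all of V costs a factor 32.
  obtain ⟨ρ, h0, h1, hρ⟩ := IsGaussianMatrix.exists_measure_abs_norm_sq_sub_one_le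
    (t := δ / 32) (by positivity) (by linarith)
  refine ⟨ρ, h0, h1, fun {Ω} _ P _ {n N} hn Φ hΦ V => ?_⟩
  obtain ⟨s, hcard, hs, hnet⟩ := exists_finset_net_subspace V
  set B : V → Set Ω := fun c => {ω | δ / 32 ≤
    |‖Matrix.toEuclideanLin (Φ ω) (c : EuclideanSpace ℝ (Fin N))‖ ^ 2 - 1|} with hB
  have hsub : {ω | ¬ ∀ v ∈ V, |‖Matrix.toEuclideanLin (Φ ω) v‖ ^ 2 - ‖v‖ ^ 2| ≤ δ * ‖v‖ ^ 2} ⊆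
      ⋃ c ∈ s, B c := by
    intro ω hω
    by_contra hcon
    simp only [Set.mem_iUnion, not_exists] at hcon
    refine hω fun v hv => ?_
    have := hnet (Matrix.toEuclideanLin (Φ ω)) (δ / 32) (fun c hc => (not_le.1 (hcon c hc)).le) v hv
    rwa [mul_div_cancel₀ _ (by norm_num : (32 : ℝ) ≠ 0)] at this
  have hunion : P.real (⋃ c ∈ s, B c) ≤ ∑ c ∈ s, P.real (B c) := measureReal_biUnion_finset_le s B
  have hsum : ∑ c ∈ s, P.real (B c) ≤ s.card • (2 * ρ ^ n) :=
    Finset.sum_le_card_nsmul s _ _ fun c hc => hρ P hn Φ hΦ c (hs c hc)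
  have hcard' : (s.card : ℝ) ≤ 5 ^ Module.finrank ℝ V := by exact_mod_cast hcard
  rw [nsmul_eq_mul] at hsum
  exact (measureReal_mono hsub (measure_ne_top P _)).trans (hunion.trans (hsum.trans
    (mul_le_mul_of_nonneg_right hcard' (by positivity))))

/-! ### Choice of constants and union bound -/

lemma exists_forall_pow_mul_pow_le {ε ρ : ℝ} (hε : 0 < ε) (h0 : 0 < ρ) (h1 : ρ < 1) :
    ∃ c : ℝ, 0 < c ∧ c < ε ∧ ∃ n₀ : ℕ, n₀ ≠ 0 ∧ ∀ d n : ℕ, n₀ ≤ n → (d : ℝ) ≤ c * n →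
      (5 : ℝ) ^ (2 * d) * (2 * ρ ^ n) ≤ 2 / (ε ^ 2 * n) := by
  have hlog : Real.log ρ < 0 := Real.log_neg h0 h1
  -- Half of the decay of ρⁿ = e^{-2κn} pays for 25^d ≤ e^{κn}; the remaining e^{-κn} beats 1/n.
  set κ := -Real.log ρ / 2 with hκ
  have hκ0 : 0 < κ := by linarith
  have hl : 0 < Real.log 25 := Real.log_pos (by norm_num)
  have hlim : Filter.Tendsto (fun n : ℕ => (n : ℝ) * Real.exp (-κ) ^ n) Filter.atTop (nhds 0) :=
    tendsto_self_mul_const_pow_of_lt_one (Real.exp_pos _).le (by rw [Real.exp_lt_one_iff]; linarith)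
  obtain ⟨m, hm⟩ := Filter.eventually_atTop.1
    (hlim.eventually_le_const (show (0 : ℝ) < 1 / ε ^ 2 by positivity))
  refine ⟨min (ε / 2) (κ / Real.log 25), by positivity,
    (min_le_left _ _).trans_lt (by linarith), max m 1, by positivity, fun d n hn hd => ?_⟩
  have hn1 : 0 < n := lt_of_lt_of_le one_pos ((le_max_right m 1).trans hn)
  have hn' : (0 : ℝ) < n := by exact_mod_cast hn1
  have hd' : d * Real.log 25 ≤ κ * n := by
    rw [← le_div_iff₀ hl]
    refine hd.trans ?_
    rw [mul_div_right_comm]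
    gcongr
    exact min_le_right _ _
  have hexp : (5 : ℝ) ^ (2 * d) * ρ ^ n ≤ Real.exp (-κ) ^ n := by
    rw [pow_mul, show (5 : ℝ) ^ 2 = 25 by norm_num,
      ← Real.exp_log (show (0 : ℝ) < 25 by norm_num), ← Real.exp_nat_mul, ← Real.exp_nat_mul]
    nth_rewrite 1 [← Real.exp_log h0]
    rw [← Real.exp_nat_mul, ← Real.exp_add, Real.exp_le_exp]
    have : Real.log ρ = -(2 * κ) := by rw [hκ]; ring
    rw [this]
    linarith
  have hm' := hm n ((le_max_left m 1).trans hn)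
  rw [le_div_iff₀ (by positivity)] at hm' ⊢
  have h2 := mul_le_mul_of_nonneg_left hexp (show 0 ≤ 2 * (ε ^ 2 * (n : ℝ)) by positivity)
  linarith

open scoped Matrix.Norms.Frobenius in
lemma projFDist_self {m : ℕ} (U : Submodule ℝ (EuclideanSpace ℝ (Fin m))) :
    projFDist U U = 0 := by
  rw [projFDist, sub_self, norm_zero, mul_zero]

theorem theorem1 (ε : ℝ) (hε : 0 < ε) :
    ∃ c : ℝ, 0 < c ∧ c < ε ∧ ∃ n₀ : ℕ,
      ∀ (d n N L : ℕ), n₀ ≤ n → (d : ℝ) ≤ c * n → n < N →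
      ∀ X : Fin L → Submodule ℝ (EuclideanSpace ℝ (Fin N)),
        (∀ k, Module.finrank ℝ (X k) ≤ d) →
      ∀ {Ω : Type*} [MeasurableSpace Ω] (P : Measure Ω) [IsProbabilityMeasure P]
        (Φ : Ω → Matrix (Fin n) (Fin N) ℝ), IsGaussianMatrix P Φ →
        1 - 2 * (d : ℝ) * L * ((L : ℝ) - 1) / ((ε - (d : ℝ) / n) ^ 2 * n) ≤
          P.real {ω | ∀ i j : Fin L,
            (1 - ε) * projFDist (X i) (X j) ^ 2 ≤
                projFDist (projectSubspace (Φ ω) (X i)) (projectSubspace (Φ ω) (X j)) ^ 2 ∧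
              projFDist (projectSubspace (Φ ω) (X i)) (projectSubspace (Φ ω) (X j)) ^ 2 ≤
                (1 + ε) * projFDist (X i) (X j) ^ 2} := by
  have hδε : ε / (2 + ε) * (2 + ε) = ε := div_mul_cancel₀ _ (by positivity)
  obtain ⟨ρ, h0, h1, hρ⟩ := IsGaussianMatrix.exists_measure_distortion_le
    (δ := ε / (2 + ε)) (by positivity) ((div_le_one (by positivity)).2 (by linarith))
  obtain ⟨c, hc0, hcε, n₀, hn₀, hc⟩ := exists_forall_pow_mul_pow_le hε h0 h1
  refine ⟨c, hc0, hcε, n₀, fun d n N L hn hd _ X hX {Ω} _ P _ Φ hΦ => ?_⟩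
  have hn0 : n ≠ 0 := by omega
  have hn' : (0 : ℝ) < n := by positivity
  rcases Nat.eq_zero_or_pos d with rfl | hd0
  -- For d = 0 the claimed probability is 1, so the event must be certain: all subspaces and their
  -- images are zero.
  · have hbot : ∀ k, X k = ⊥ := fun k => Submodule.finrank_eq_zero.1 (Nat.le_zero.1 (hX k))
    simp [hbot, projFDist_self]
  set G : Set Ω := {ω | ∀ i j : Fin L,
    (1 - ε) * projFDist (X i) (X j) ^ 2 ≤
        projFDist (projectSubspace (Φ ω) (X i)) (projectSubspace (Φ ω) (X j)) ^ 2 ∧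
      projFDist (projectSubspace (Φ ω) (X i)) (projectSubspace (Φ ω) (X j)) ^ 2 ≤
        (1 + ε) * projFDist (X i) (X j) ^ 2} with hG
  set B : Fin L × Fin L → Set Ω := fun p => {ω | ¬ ∀ v ∈ X p.1 ⊔ X p.2,
    |‖Matrix.toEuclideanLin (Φ ω) v‖ ^ 2 - ‖v‖ ^ 2| ≤ ε / (2 + ε) * ‖v‖ ^ 2} with hB
  have hcover : (Set.univ : Set Ω) ⊆ G ∪ ⋃ p ∈ (Finset.univ : Finset (Fin L)).offDiag, B p := by
    intro ω _
    by_contra hω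
    rw [Set.mem_union, not_or] at hω
    obtain ⟨hωG, hωB⟩ := hω
    refine hωG fun i j => ?_
    rcases eq_or_ne i j with rfl | hij
    · simp [projFDist_self]
    · refine projFDist_map_sq_bounds _ _ _ hε (by positivity) hδε.le ?_
      by_contra hcon
      exact hωB (Set.mem_biUnion (x := (i, j)) (by simpa using hij) hcon)
  have hBp : ∀ p, P.real (B p) ≤ 2 / (ε ^ 2 * n) := by
    intro p
    refine (hρ P hn0 Φ hΦ _).trans (le_trans ?_ (hc d n hn hd))
    have hdim : Module.finrank ℝ ↥(X p.1 ⊔ X p.2) ≤ 2 * d :=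
      (Submodule.finrank_add_le_finrank_add_finrank _ _).trans (by linarith [hX p.1, hX p.2])
    gcongr
    norm_num
  have hsum : P.real (⋃ p ∈ (Finset.univ : Finset (Fin L)).offDiag, B p) ≤
      L * ((L : ℝ) - 1) * (2 / (ε ^ 2 * n)) := by
    refine (measureReal_biUnion_finset_le _ _).trans ((Finset.sum_le_sum fun p _ => hBp p).trans_eq ?_)
    rw [Finset.sum_const, nsmul_eq_mul, Finset.offDiag_card, Finset.card_fin,
      Nat.cast_sub (Nat.le_mul_self L), Nat.cast_mul]
    ring
  -- Subadditivity on a cover avoids any measurability of G.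
  have hone : 1 ≤ P.real G + P.real (⋃ p ∈ (Finset.univ : Finset (Fin L)).offDiag, B p) := by
    rw [← probReal_univ (μ := P)]
    exact (measureReal_mono hcover).trans (measureReal_union_le _ _)
  have hdn : (d : ℝ) / n ≤ c := (div_le_iff₀ hn').2 hd
  have hdn0 : 0 ≤ (d : ℝ) / n := by positivity
  have hgap : 0 < ε - (d : ℝ) / n := by linarith
  have hL : 0 ≤ (L : ℝ) * ((L : ℝ) - 1) := by
    rcases Nat.eq_zero_or_pos L with rfl | hL
    · simp
    · have : (1 : ℝ) ≤ L := by exact_mod_cast hL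
      exact mul_nonneg (by linarith) (by linarith)
  have hd1 : (1 : ℝ) ≤ d := by exact_mod_cast hd0
  -- Since d ≥ 1 and 0 < ε - d/n ≤ ε, the stated failure bound is weaker than the one proved.
  have hfin : L * ((L : ℝ) - 1) * (2 / (ε ^ 2 * n)) ≤
      2 * (d : ℝ) * L * ((L : ℝ) - 1) / ((ε - (d : ℝ) / n) ^ 2 * n) := by
    rw [show 2 * (d : ℝ) * L * ((L : ℝ) - 1) / ((ε - (d : ℝ) / n) ^ 2 * n) =
      L * ((L : ℝ) - 1) * (2 * d / ((ε - (d : ℝ) / n) ^ 2 * n)) by ring]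
    refine mul_le_mul_of_nonneg_left ?_ hL
    gcongr
    · linarith
    · linarith
  linarith
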